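/- \textbf{Model.} For an integer $r\ge 1$, consider $n$ nodes forming an undirected graph $G$, with pairwise distinct identities in $\mathbb{N}$ that are at most $p(n)$, where $p$ is a fixed polynomial; $n$, $p$ and $r$ are known to all nodes. The input of a node $v$ consists of its identity together with the subgraph of $G$ induced by the nodes at distance at most $r$ from $v$ (whose nodes are labelled by their identities). In a deterministic one-round protocol with $b$-bit messages, each node $v$ broadcasts one message of $b$ bits, which is a function of its input, and then computes its output as a function of its input and of the multiset of messages sent by all the nodes (a message carries no indication of its sender other than what is written in its bits). \textbf{Theorem.} For every polynomial $p$ with coefficients in $\mathbb{N}$ there is a constant $C$ such that for all integers $r\ge 1$ and $n\ge 0$ there is a deterministic one-round protocol with messages of at most $C\, n^{1/r}\log n$ bits such that, for every graph $G$ on $n$ nodes and every assignment of distinct identities at most $p(n)$ to its nodes, all nodes produce the same output, and this output consists of the family of the vertex sets of the connected components of $G$ and of a spanning forest of $G$ (that is, a maximal acyclic subgraph of $G$). -/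

import Mathlib

/-- What a node of the `r`-neighbourhood broadcast congested clique knows at the start, written
entirely in terms of node identities: its own identity, the identities of the nodes at distance
at most `r`, and the graph induced on those nodes. -/
structure LocalView where
  self : ℕ
  nodes : Set ℕ
  graph : SimpleGraph ℕ

/-- The nodes at distance at most `r` from `v`; nodes in other components are at distance `⊤`. -/
def distBall {V : Type*} (G : SimpleGraph V) (r : ℕ) (v : V) : Set V :=
  {u | G.edist v u ≤ (r : ℕ∞)}

/-- The input of node `v` in the graph `G` whose nodes carry the identities `ids`. -/
def localView {V : Type*} (ids : V ↪ ℕ) (G : SimpleGraph V) (r : ℕ) (v : V) : LocalView where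
  self := ids v
  nodes := ids '' distBall G r v
  graph := (G.induce (distBall G r v)).map ((Function.Embedding.subtype _).trans ids)

/-- A deterministic one-round broadcast protocol with messages of `b` bits and outputs in `Out`.
Each node computes one message from its input and broadcasts it; then it computes its output
from its input and the messages sent by all nodes (its own included). The messages arrive
without sender information: a protocol that needs the sender's identity must pay for it by
writing it into the message. -/
structure OneRoundProtocol (b : ℕ) (Out : Type*) where
  message : LocalView → (Fin b → Bool)
  output : LocalView → Multiset (Fin b → Bool) → Out

/-- The output of node `v` when the protocol is run on the graph `G` with identities `ids`. -/
def OneRoundProtocol.run {b : ℕ} {Out : Type*} (P : OneRoundProtocol b Out) {V : Type*}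
    [Fintype V] (ids : V ↪ ℕ) (G : SimpleGraph V) (r : ℕ) (v : V) : Out :=
  P.output (localView ids G r v)
    ((Finset.univ : Finset V).val.map fun u => P.message (localView ids G r u))

/-- A (maximal) spanning forest of `G`: a maximal acyclic subgraph on the vertices of `G`. -/
def IsSpanningForest {V : Type*} (G F : SimpleGraph V) : Prop :=
  Maximal (fun H : SimpleGraph V => H ≤ G ∧ H.IsAcyclic) F

/-- Output of a connectivity protocol, in terms of identities: the family of the vertex sets of
the connected components, and the edges of a forest. -/
structure ConnectivityOutput where
  components : Set (Set ℕ)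
  forest : SimpleGraph ℕ

/-- The output lists exactly the connected components of `G` and gives a spanning forest. -/
def ConnectivityOutput.IsCorrect {V : Type*} (out : ConnectivityOutput) (ids : V ↪ ℕ)
    (G : SimpleGraph V) : Prop :=
  out.components = Set.range (fun c : G.ConnectedComponent => ids '' c.supp) ∧
    ∃ F : SimpleGraph V, IsSpanningForest G F ∧ out.forest = F.map ids

/-! Rank the possible edges injectively and delete every edge of largest rank in some cycle of
length at most `2 * r`. The remaining graph keeps the connectivity of `G` (`reachable_prune`) and
has no short cycles. Each node knows its own remaining edges, since a short cycle through it lies in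
its ball of radius `r` (`prune_adj_iff_of_ball`). With `n < k ^ r`, Moore's bound gives every
nonempty vertex set `S` a vertex with at most `k` neighbours in `S` (`exists_card_filter_adj_le`).
So `2 * k` power sums per neighbourhood suffice: if two graphs share them, take `S` to be the
vertices where they differ. At a vertex of `S` with few neighbours in `S`, the neighbourhoods differ
in at most `2 * k` elements, and equal power sums force them to agree
(`eq_of_powerSums_neighborSet_eq`). A message is thus `2 * k + 1` residues modulo a prime of
polynomial size, with `k` about `n ^ (1 / r)`. -/

namespace SimpleGraph

/-! ### Graphs of large girth and Moore's bound -/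

variable {V : Type*} {G : SimpleGraph V}

/-- In a graph whose cycles are all longer than `m`, two paths with the same ends and total length
at most `m` coincide. -/
theorem eq_of_isPath_of_lt_cycle_length {m : ℕ}
    (hG : ∀ ⦃x : V⦄ (c : G.Walk x x), c.IsCycle → m < c.length) {u v : V} {p q : G.Walk u v}
    (hp : p.IsPath) (hq : q.IsPath) (hlen : p.length + q.length ≤ m) : p = q := by
  classical
  -- The union of the two paths has at most `m` edges, too few for a cycle, so it is a forest.
  set K : SimpleGraph V := fromEdgeSet {e | e ∈ p.edges ++ q.edges} with hK
  have hKG : K ≤ G := by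
    intro a b hab
    rw [hK, fromEdgeSet_adj, Set.mem_ofPred_eq, List.mem_append] at hab
    exact hab.1.elim (fun h => p.adj_of_mem_edges h) (fun h => q.adj_of_mem_edges h)
  have hmem : ∀ e ∈ p.edges ++ q.edges, e ∈ K.edgeSet := by
    intro e he
    rw [hK, edgeSet_fromEdgeSet]
    refine ⟨he, fun hd => ?_⟩
    rcases List.mem_append.1 he with h | h
    · exact G.not_isDiag_of_mem_edgeSet (p.edges_subset_edgeSet h) hd
    · exact G.not_isDiag_of_mem_edgeSet (q.edges_subset_edgeSet h) hd
  have hac : K.IsAcyclic := by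
    intro x c hc
    have h1 := hG (c.mapLe hKG) (hc.mapLe hKG)
    have h2 : c.edges ⊆ p.edges ++ q.edges := by
      intro e he
      have := c.edges_subset_edgeSet he
      rw [hK, edgeSet_fromEdgeSet] at this
      exact this.1
    have h3 := (List.subperm_of_subset hc.isTrail.edges_nodup h2).length_le
    simp only [List.length_append, Walk.length_edges] at h3
    simp only [Walk.mapLe, Walk.length_map] at h1
    omega
  have hp' := hp.transfer (H := K) (fun e he => hmem e (List.mem_append_left _ he))
  have hq' := hq.transfer (H := K) (fun e he => hmem e (List.mem_append_right _ he))
  have := congrArg (fun w : K.Path u v => w.1.support) ((hac.subsingleton_path u v).elim ⟨_, hp'⟩ ⟨_, hq'⟩)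
  simp only [Walk.support_transfer] at this
  exact Walk.ext_support this

/-- Moore's bound, for the vertices of `S` reached by a path of length `i`. -/
theorem pow_le_card_filter_exists_path {r d : ℕ}
    (hG : ∀ ⦃x : V⦄ (c : G.Walk x x), c.IsCycle → 2 * r < c.length) {S : Finset V}
    [DecidableRel G.Adj] (hS : ∀ w ∈ S, d + 1 ≤ (S.filter (G.Adj w)).card) {v : V} (hv : v ∈ S)
    {i : ℕ} (hi : i ≤ r) :
    d ^ i ≤ Set.ncard {w | w ∈ S ∧ ∃ p : G.Walk v w, p.IsPath ∧ p.length = i} := by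
  classical
  have hncard : ∀ i, Set.ncard {w | w ∈ S ∧ ∃ p : G.Walk v w, p.IsPath ∧ p.length = i} =
      (S.filter fun w => ∃ p : G.Walk v w, p.IsPath ∧ p.length = i).card := by
    intro i
    rw [← Set.ncard_coe_finset]
    simp
  rw [hncard]
  induction i with
  | zero =>
    rw [pow_zero, Finset.one_le_card]
    exact ⟨v, Finset.mem_filter.2 ⟨hv, Walk.nil, Walk.IsPath.nil, rfl⟩⟩
  | succ i ih =>
    set A := S.filter fun w => ∃ p : G.Walk v w, p.IsPath ∧ p.length = i with hA
    have hx : ∀ w, ∃ x : V, w ∈ A →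
        ∃ p : G.Walk v w, p.IsPath ∧ p.length = i ∧ p.penultimate = x := by
      intro w
      by_cases hw : w ∈ A
      · obtain ⟨-, p, hp, hl⟩ := Finset.mem_filter.1 hw
        exact ⟨_, fun _ => ⟨p, hp, hl, rfl⟩⟩
      · exact ⟨v, fun h => absurd h hw⟩
    choose x hx using hx
    have hext : ∀ w ∈ A, ∀ u, G.Adj w u → u ≠ x w →
        ∃ p : G.Walk v u, p.IsPath ∧ p.length = i + 1 ∧ p.penultimate = w := by
      intro w hw u hwu hux
      obtain ⟨p, hp, hl, hpx⟩ := hx w hw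
      refine ⟨p.concat hwu, hp.concat (fun hu => hux ?_) hwu, by simp [hl], by simp⟩
      -- If `u` were on `p`, the rest of `p` from `u` to `w` and the edge `uw` would be two short
      -- paths, hence equal, making `u` the penultimate vertex `x w`.
      have h1 : p.dropUntil u hu = hwu.symm.toWalk := by
        refine eq_of_isPath_of_lt_cycle_length hG (hp.dropUntil hu) ?_ ?_
        · simp [hwu.ne']
        · have := p.length_dropUntil_le_length hu
          simp only [Walk.length_cons, Walk.length_nil]
          omega
      have h2 : p = (p.takeUntil u hu).concat hwu.symm := by
        conv_lhs => rw [← p.take_spec hu, h1]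
        rfl
      rw [← hpx, h2, Walk.penultimate_concat]
    have hsub : (A.biUnion fun w => (S.filter (G.Adj w)).erase (x w)) ⊆
        S.filter fun w => ∃ p : G.Walk v w, p.IsPath ∧ p.length = i + 1 := by
      intro u hu
      obtain ⟨w, hw, hu⟩ := Finset.mem_biUnion.1 hu
      rw [Finset.mem_erase, Finset.mem_filter] at hu
      obtain ⟨p, hp, hl, -⟩ := hext w hw u hu.2.2 hu.1
      exact Finset.mem_filter.2 ⟨hu.2.1, p, hp, hl⟩
    refine le_trans ?_ (Finset.card_le_card hsub)
    rw [Finset.card_biUnion]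
    · calc d ^ (i + 1) = d ^ i * d := pow_succ _ _
        _ ≤ A.card * d := Nat.mul_le_mul_right _ (ih (by omega))
        _ ≤ _ := by
          rw [← smul_eq_mul]
          refine Finset.card_nsmul_le_sum _ _ _ fun w hw => ?_
          have h1 := hS w (Finset.mem_filter.1 hw).1
          have h2 := Finset.pred_card_le_card_erase (s := S.filter (G.Adj w)) (a := x w)
          omega
    · intro w hw w' hw' hne
      refine Finset.disjoint_left.2 fun u hu hu' => hne ?_
      rw [Finset.mem_erase, Finset.mem_filter] at hu hu'
      obtain ⟨p, hp, hl, hpw⟩ := hext w hw u hu.2.2 hu.1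
      obtain ⟨p', hp', hl', hpw'⟩ := hext w' hw' u hu'.2.2 hu'.1
      rw [← hpw, ← hpw', eq_of_isPath_of_lt_cycle_length hG hp hp' (by omega)]

/-- A graph whose cycles are all longer than `2 * r` has, in every nonempty set of fewer than
`k ^ r` vertices, a vertex with at most `k` neighbours in the set. -/
theorem exists_card_filter_adj_le {r k : ℕ}
    (hG : ∀ ⦃x : V⦄ (c : G.Walk x x), c.IsCycle → 2 * r < c.length) [DecidableRel G.Adj]
    {S : Finset V} (hS : S.Nonempty) (hcard : S.card < k ^ r) :
    ∃ v ∈ S, (S.filter (G.Adj v)).card ≤ k := by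
  by_contra! h
  obtain ⟨v, hv⟩ := hS
  refine absurd hcard (not_lt.2 ?_)
  refine (pow_le_card_filter_exists_path hG (fun w hw => h w hw) hv le_rfl).trans ?_
  rw [← Set.ncard_coe_finset S]
  exact Set.ncard_le_ncard (fun w hw => hw.1) S.finite_toSet

/-! ### Pruning short cycles -/

/-- Delete every edge that has the largest rank in some cycle of length at most `m`. -/
def prune (rank : Sym2 V → ℕ) (m : ℕ) (G : SimpleGraph V) : SimpleGraph V :=
  G.deleteEdges {e | ∃ x, ∃ c : G.Walk x x, c.IsCycle ∧ c.length ≤ m ∧ e ∈ c.edges ∧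
    ∀ e' ∈ c.edges, rank e' ≤ rank e}

theorem prune_le (rank : Sym2 V → ℕ) (m : ℕ) (G : SimpleGraph V) : G.prune rank m ≤ G :=
  deleteEdges_le _

theorem lt_length_of_isCycle_prune (rank : Sym2 V → ℕ) (m : ℕ) {x : V}
    (c : (G.prune rank m).Walk x x) (hc : c.IsCycle) : m < c.length := by
  classical
  by_contra! hm
  have hne : c.edges.toFinset.Nonempty := by
    rw [List.toFinset_nonempty_iff, ← List.length_pos_iff, Walk.length_edges]
    have := hc.three_le_length
    omega
  obtain ⟨e, he, hmax⟩ := Finset.exists_max_image _ rank hne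
  rw [List.mem_toFinset] at he
  have h1 := c.edges_subset_edgeSet he
  rw [prune, edgeSet_deleteEdges] at h1
  have hle := G.prune_le rank m
  refine h1.2 ⟨x, c.mapLe hle, hc.mapLe hle, by simpa [Walk.mapLe] using hm, by simpa, ?_⟩
  intro e' he'
  exact hmax e' (by simpa using he')

/-- By strong induction on the rank: a deleted edge closes a cycle whose other edges have smaller
rank, so their ends are already joined. -/
theorem reachable_prune {rank : Sym2 V → ℕ} (hrank : Function.Injective rank) (m : ℕ) :
    (G.prune rank m).Reachable = G.Reachable := by
  have key : ∀ k a b, G.Adj a b → rank s(a, b) = k → (G.prune rank m).Reachable a b := by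
    intro k
    induction k using Nat.strong_induction_on with
    | _ k ih =>
    intro a b hab hk
    by_cases h : (G.prune rank m).Adj a b
    · exact h.reachable
    rw [prune, deleteEdges_adj] at h
    simp only [hab, true_and, not_not, Set.mem_ofPred_eq] at h
    obtain ⟨x, c, hc, -, he, hmax⟩ := h
    -- Restricting to the edges of the cycle keeps the detour from `a` to `b` on edges of smaller
    -- rank.
    set K : SimpleGraph V := fromEdgeSet {e | e ∈ c.edges} with hK
    have hcK : ∀ e ∈ c.edges, e ∈ K.edgeSet := fun e h => by
      rw [hK, edgeSet_fromEdgeSet]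
      exact ⟨h, fun hd => G.not_isDiag_of_mem_edgeSet (c.edges_subset_edgeSet h) hd⟩
    have hreach := (adj_and_reachable_delete_edges_iff_exists_cycle (G := K) (v := a) (w := b)).2
      ⟨x, c.transfer K hcK, hc.transfer hcK, by simpa using he⟩
    obtain ⟨w⟩ := hreach.2
    have hstep : ∀ {y z : V}, (K.deleteEdges {s(a, b)}).Walk y z →
        (G.prune rank m).Reachable y z := by
      intro y z w
      induction w with
      | nil => exact Reachable.refl _
      | @cons y y' z hyy' _ ihw =>
        refine Reachable.trans ?_ ihw
        rw [deleteEdges_adj, hK, fromEdgeSet_adj, Set.mem_singleton_iff] at hyy'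
        refine ih _ ?_ y y' (c.adj_of_mem_edges hyy'.1.1) rfl
        rw [← hk]
        exact lt_of_le_of_ne (hmax _ hyy'.1.1) fun h => hyy'.2 (hrank h)
    exact hstep w
  ext a b
  refine ⟨fun h => h.mono (G.prune_le rank m), ?_⟩
  rintro ⟨w⟩
  induction w with
  | nil => exact Reachable.refl _
  | cons h _ ih => exact (key _ _ _ h rfl).trans ih

/-- Every vertex of a closed walk of length at most `2 * r` is joined to any given vertex of it by
a walk of length at most `r`. -/
theorem Walk.exists_length_le_of_mem_support {r : ℕ} {x a y : V} (c : G.Walk x x)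
    (hc : c.length ≤ 2 * r) (ha : a ∈ c.support) (hy : y ∈ c.support) :
    ∃ w : G.Walk a y, w.length ≤ r := by
  classical
  have hy' : y ∈ (c.rotate a ha).support := by
    simpa using hy
  have h1 := congrArg Walk.length ((c.rotate a ha).take_spec hy')
  rw [Walk.length_append, Walk.length_rotate] at h1
  by_cases h : ((c.rotate a ha).takeUntil y hy').length ≤ r
  · exact ⟨_, h⟩
  · exact ⟨((c.rotate a ha).dropUntil y hy').reverse, by rw [Walk.length_reverse]; omega⟩

/-- The edges at `a` of the pruned graph are determined by the ball of radius `r` around `a`. -/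
theorem prune_adj_iff_of_ball {r : ℕ} (hr : 1 ≤ r) (rank : Sym2 V → ℕ) {L : SimpleGraph V}
    {B : Set V} (hL : ∀ x y, L.Adj x y ↔ G.Adj x y ∧ x ∈ B ∧ y ∈ B) {a : V}
    (hB : ∀ y (w : G.Walk a y), w.length ≤ r → y ∈ B) (b : V) :
    (L.prune rank (2 * r)).Adj a b ↔ (G.prune rank (2 * r)).Adj a b := by
  have hLG : L ≤ G := fun x y h => ((hL x y).1 h).1
  have hab : L.Adj a b ↔ G.Adj a b := by
    refine ⟨fun h => hLG h, fun h => (hL a b).2 ⟨h, hB a Walk.nil (Nat.zero_le _), ?_⟩⟩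
    exact hB b h.toWalk (by simpa using hr)
  rw [prune, prune, deleteEdges_adj, deleteEdges_adj, hab, Set.mem_ofPred_eq, Set.mem_ofPred_eq]
  refine and_congr_right fun _ => not_congr ⟨?_, ?_⟩
  · rintro ⟨x, c, hc, hl, he, hmax⟩
    exact ⟨x, c.mapLe hLG, hc.mapLe hLG, by simpa [Walk.mapLe] using hl, by simpa using he,
      by simpa using hmax⟩
  · rintro ⟨x, c, hc, hl, he, hmax⟩
    have hmem : ∀ y ∈ c.support, y ∈ B := fun y hy => by
      obtain ⟨w, hw⟩ := c.exists_length_le_of_mem_support hl (c.fst_mem_support_of_mem_edges he) hy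
      exact hB y w hw
    have hcL : ∀ e ∈ c.edges, e ∈ L.edgeSet := by
      intro e h
      induction e with
      | _ y z =>
        exact (hL y z).2 ⟨c.adj_of_mem_edges h, hmem _ (c.fst_mem_support_of_mem_edges h),
          hmem _ (c.snd_mem_support_of_mem_edges h)⟩
    exact ⟨x, c.transfer L hcL, hc.transfer hcL, by simpa using hl, by simpa using he,
      by simpa using hmax⟩

end SimpleGraph

/-! ### Recovering sets and graphs from power sums -/

/-- Two finite sets whose difference has at most `m` elements and whose first `m` power sums agree
are equal. -/
theorem Finset.eq_of_sum_pow_eq {ι F : Type*} [Field F] [DecidableEq ι] {f : ι → F} {A B : Finset ι}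
    {m : ℕ} (hf : Set.InjOn f (A ∪ B : Finset ι)) (hcard : (A \ B).card + (B \ A).card ≤ m)
    (hsum : ∀ i < m, ∑ a ∈ A, f a ^ i = ∑ b ∈ B, f b ^ i) : A = B := by
  classical
  have hpoly : ∀ P : Polynomial F, P.natDegree < m →
      ∑ a ∈ A, P.eval (f a) = ∑ b ∈ B, P.eval (f b) := by
    intro P hP
    simp_rw [Polynomial.eval_eq_sum_range' hP]
    rw [Finset.sum_comm, Finset.sum_comm (s := B)]
    refine Finset.sum_congr rfl fun i hi => ?_
    rw [← Finset.mul_sum, ← Finset.mul_sum, hsum i (Finset.mem_range.1 hi)]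
  have hdiff : ∀ P : Polynomial F, P.natDegree < m →
      ∑ a ∈ A \ B, P.eval (f a) = ∑ b ∈ B \ A, P.eval (f b) := by
    intro P hP
    have h := hpoly P hP
    rw [← Finset.sum_inter_add_sum_sdiff A B, ← Finset.sum_inter_add_sum_sdiff B A,
      Finset.inter_comm B A] at h
    exact add_left_cancel h
  set D := A \ B ∪ B \ A with hD
  have hDcard : D.card ≤ m := (Finset.card_union_le _ _).trans hcard
  have hinj : ∀ x ∈ D, ∀ y ∈ D, f x = f y → x = y := by
    intro x hx y hy h
    refine hf ?_ ?_ h <;> grind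
  have hP : ∀ x ∈ D, ∃ P : Polynomial F, P.natDegree < m ∧ P.eval (f x) ≠ 0 ∧
      ∀ y ∈ D, y ≠ x → P.eval (f y) = 0 := by
    intro x hx
    -- Unnormalised Lagrange polynomials: they isolate one point of the symmetric difference.
    refine ⟨∏ y ∈ D.erase x, (Polynomial.X - Polynomial.C (f y)), ?_, ?_, ?_⟩
    · rw [Polynomial.natDegree_finsetProd_X_sub_C_eq_card]
      exact (Finset.card_erase_lt_of_mem hx).trans_le hDcard
    · rw [Polynomial.eval_prod, Finset.prod_ne_zero_iff]
      intro y hy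
      simp only [Polynomial.eval_sub, Polynomial.eval_X, Polynomial.eval_C]
      exact sub_ne_zero.2 fun h =>
        Finset.ne_of_mem_erase hy (hinj x hx y (Finset.mem_of_mem_erase hy) h).symm
    · intro y hy hne
      rw [Polynomial.eval_prod]
      exact Finset.prod_eq_zero (Finset.mem_erase.2 ⟨hne, hy⟩) (by simp)
  by_contra hAB
  have hDne : ∃ x, x ∈ D := by
    by_contra! h
    exact hAB (Finset.ext fun x => by have := h x; grind)
  obtain ⟨x, hx⟩ := hDne
  obtain ⟨P, hdeg, hne, h0⟩ := hP x hx
  have h := hdiff P hdeg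
  rcases Finset.mem_union.1 hx with hxA | hxB
  · rw [Finset.sum_eq_single_of_mem x hxA fun y hy hyx =>
        h0 y (Finset.mem_union_left _ hy) hyx,
      Finset.sum_eq_zero fun y hy => h0 y (Finset.mem_union_right _ hy) (by grind)] at h
    exact hne h
  · rw [Finset.sum_eq_single_of_mem (s := B \ A) x hxB fun y hy hyx =>
        h0 y (Finset.mem_union_right _ hy) hyx,
      Finset.sum_eq_zero fun y hy => h0 y (Finset.mem_union_left _ hy) (by grind)] at h
    exact hne h.symm

/-- The first `m` power sums modulo `q` of the elements of a set of natural numbers. -/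
noncomputable def powerSums (q m : ℕ) (N : Set ℕ) : Fin m → ZMod q :=
  fun i => ∑ᶠ b ∈ N, (b : ZMod q) ^ (i : ℕ)

/-- A graph without cycles of length at most `2 * r` on fewer than `k ^ r` vertices is determined
by the first `2 * k` power sums of its neighbourhoods. -/
theorem SimpleGraph.eq_of_powerSums_neighborSet_eq {q r k : ℕ} [Fact q.Prime] (hk : 1 ≤ k)
    {I : Finset ℕ} (hIq : ∀ a ∈ I, a < q) (hI : I.card < k ^ r) {H H' : SimpleGraph ℕ}
    (hH : ∀ a b, H.Adj a b → a ∈ I) (hH' : ∀ a b, H'.Adj a b → a ∈ I)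
    (hcyc : ∀ ⦃x : ℕ⦄ (c : H.Walk x x), c.IsCycle → 2 * r < c.length)
    (hsum : ∀ a ∈ I, powerSums q (2 * k) (H.neighborSet a) =
      powerSums q (2 * k) (H'.neighborSet a)) : H = H' := by
  classical
  by_contra hne
  set S := I.filter fun a => ∃ b, ¬(H.Adj a b ↔ H'.Adj a b) with hS
  have hSne : S.Nonempty := by
    by_contra h
    refine hne ?_
    ext a b
    by_contra hab
    have ha : a ∈ I := by
      by_contra ha
      exact hab ⟨fun h => absurd (hH _ _ h) ha, fun h => absurd (hH' _ _ h) ha⟩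
    exact h ⟨a, Finset.mem_filter.2 ⟨ha, b, hab⟩⟩
  obtain ⟨v, hvS, hv⟩ := SimpleGraph.exists_card_filter_adj_le hcyc hSne
    ((Finset.card_le_card (Finset.filter_subset _ _)).trans_lt hI)
  obtain ⟨hvI, u, hu⟩ := Finset.mem_filter.1 hvS
  have hpow : ∀ K : SimpleGraph ℕ, (∀ a b, K.Adj a b → a ∈ I) → ∀ i : Fin (2 * k),
      powerSums q (2 * k) (K.neighborSet v) i = ∑ b ∈ I.filter (K.Adj v), (b : ZMod q) ^ (i : ℕ) := by
    intro K hK i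
    rw [powerSums, ← finsum_mem_coe_finset]
    refine finsum_mem_congr ?_ fun _ _ => rfl
    ext b
    simp only [SimpleGraph.mem_neighborSet, Finset.coe_filter, Set.mem_ofPred_eq]
    exact ⟨fun h => ⟨hK _ _ h.symm, h⟩, fun h => h.2⟩
  have hsum' : ∀ i < 2 * k, ∑ b ∈ I.filter (H.Adj v), (b : ZMod q) ^ i =
      ∑ b ∈ I.filter (H'.Adj v), (b : ZMod q) ^ i := by
    intro i hi
    rw [← hpow H hH ⟨i, hi⟩, ← hpow H' hH' ⟨i, hi⟩, hsum v hvI]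
  have hlt : ∀ K : SimpleGraph ℕ, (I.filter (K.Adj v)).card < q := by
    intro K
    have hsub : I.filter (K.Adj v) ⊆ (Finset.range q).erase v := by
      intro b hb
      rw [Finset.mem_filter] at hb
      exact Finset.mem_erase.2 ⟨hb.2.ne', Finset.mem_range.2 (hIq b hb.1)⟩
    refine (Finset.card_le_card hsub).trans_lt ?_
    simpa using Finset.card_erase_lt_of_mem (Finset.mem_range.2 (hIq v hvI))
  -- The zeroth power sum is the degree modulo `q`, and degrees are below `q`. Equal degrees turn a
  -- bound on one difference into a bound on both, so only `H` needs large girth.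
  have hcard : (I.filter (H.Adj v)).card = (I.filter (H'.Adj v)).card := by
    have h := hsum' 0 (by omega)
    simp only [pow_zero, Finset.sum_const, nsmul_eq_mul, mul_one] at h
    rw [ZMod.natCast_eq_natCast_iff'] at h
    rwa [Nat.mod_eq_of_lt (hlt H), Nat.mod_eq_of_lt (hlt H')] at h
  -- By symmetry of adjacency, an end `b` of a disputed edge at `v` is itself in `S`.
  have hdiff : (I.filter (H.Adj v) \ I.filter (H'.Adj v)).card ≤ k := by
    refine (Finset.card_le_card fun b hb => ?_).trans hv
    rw [Finset.mem_sdiff, Finset.mem_filter, Finset.mem_filter] at hb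
    exact Finset.mem_filter.2 ⟨Finset.mem_filter.2 ⟨hb.1.1, v,
      fun h => hb.2 ⟨hb.1.1, (h.1 hb.1.2.symm).symm⟩⟩, hb.1.2⟩
  have hEq := Finset.eq_of_sum_pow_eq (f := fun b : ℕ => (b : ZMod q)) (m := 2 * k) ?_ ?_ hsum'
  · refine hu ?_
    have h := Finset.ext_iff.1 hEq u
    simp only [Finset.mem_filter] at h
    exact ⟨fun h' => (h.1 ⟨hH _ _ h'.symm, h'⟩).2, fun h' => (h.2 ⟨hH' _ _ h'.symm, h'⟩).2⟩
  · intro a ha b hb hab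
    have hmem : ∀ c ∈ I.filter (H.Adj v) ∪ I.filter (H'.Adj v), c < q := by
      intro c hc
      exact hIq c (by grind)
    rw [ZMod.natCast_eq_natCast_iff'] at hab
    rwa [Nat.mod_eq_of_lt (hmem a ha), Nat.mod_eq_of_lt (hmem b hb)] at hab
  · rw [Finset.card_sdiff_comm hcard.symm]
    have := Finset.card_sdiff_comm hcard.symm
    omega

/-! ### Transfer to identities -/

namespace SimpleGraph

variable {V : Type*}

/-- A walk in the image of a graph that starts in the range comes from a walk in the graph. -/
theorem exists_walk_of_walk_map (f : V ↪ ℕ) (G : SimpleGraph V) {x y : ℕ} (w : (G.map f).Walk x y)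
    {v : V} (hv : f v = x) : ∃ u, f u = y ∧ ∃ w' : G.Walk v u, w'.length = w.length := by
  induction w generalizing v with
  | nil => exact ⟨v, hv, Walk.nil, rfl⟩
  | cons h w ih =>
    obtain ⟨v₁, v₂, hadj, h₁, h₂⟩ := (map_adj f G _ _).1 h
    obtain rfl : v₁ = v := f.injective (h₁.trans hv.symm)
    obtain ⟨u, hu, w', hw'⟩ := ih h₂
    exact ⟨u, hu, Walk.cons hadj w', by simp [hw']⟩

theorem reachable_map_iff (f : V ↪ ℕ) (G : SimpleGraph V) (v : V) (y : ℕ) :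
    (G.map f).Reachable (f v) y ↔ ∃ u, f u = y ∧ G.Reachable v u := by
  constructor
  · rintro ⟨w⟩
    obtain ⟨u, hu, w', -⟩ := exists_walk_of_walk_map f G w rfl
    exact ⟨u, hu, ⟨w'⟩⟩
  · rintro ⟨u, rfl, h⟩
    exact h.map (Embedding.map f G).toHom

end SimpleGraph

/-! ### The common output -/

section Output

variable {V : Type*}

/-- The connected components of `H` that meet `I`, and some spanning forest of `H`. -/
noncomputable def canonicalOutput (I : Set ℕ) (H : SimpleGraph ℕ) : ConnectivityOutput where
  components := {C | ∃ a ∈ I, C = {b | H.Reachable a b}}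
  forest := Classical.choose H.exists_isAcyclic_reachable_eq_le

/-- An acyclic subgraph of `G` is maximal exactly when it has the reachability relation of `G`, so a
spanning forest of `H` serves for `G`. -/
theorem canonicalOutput_isCorrect (ids : V ↪ ℕ) {G : SimpleGraph V} {H : SimpleGraph ℕ}
    (hle : H ≤ G.map ids) (hreach : H.Reachable = (G.map ids).Reachable) :
    (canonicalOutput (Set.range ids) H).IsCorrect ids G := by
  constructor
  · have hset : ∀ v, {b | H.Reachable (ids v) b} = ids '' (G.connectedComponentMk v).supp := by
      intro v
      ext y
      rw [Set.mem_ofPred_eq, hreach, SimpleGraph.reachable_map_iff]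
      simp only [Set.mem_image, SimpleGraph.ConnectedComponent.mem_supp_iff,
        SimpleGraph.ConnectedComponent.eq]
      exact ⟨fun ⟨u, hu, h⟩ => ⟨u, h.symm, hu⟩, fun ⟨u, h, hu⟩ => ⟨u, hu, h.symm⟩⟩
    ext C
    constructor
    · rintro ⟨_, ⟨v, rfl⟩, rfl⟩
      exact ⟨G.connectedComponentMk v, (hset v).symm⟩
    · rintro ⟨c, rfl⟩
      induction c using SimpleGraph.ConnectedComponent.ind with
      | _ v => exact ⟨ids v, ⟨v, rfl⟩, (hset v).symm⟩
  · obtain ⟨hFH, hac, hFr⟩ := Classical.choose_spec H.exists_isAcyclic_reachable_eq_le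
    set F := Classical.choose H.exists_isAcyclic_reachable_eq_le with hF
    have hmap : F = (F.comap ids).map ids := by
      ext a b
      rw [SimpleGraph.map_adj]
      constructor
      · intro h
        obtain ⟨u, v, -, rfl, rfl⟩ := (SimpleGraph.map_adj ids G _ _).1 (hle (hFH h))
        exact ⟨u, v, h, rfl, rfl⟩
      · rintro ⟨u, v, h, rfl, rfl⟩
        exact h
    refine ⟨F.comap ids, ?_, hmap⟩
    have hFG : F.comap ids ≤ G := by
      intro u v h
      exact (SimpleGraph.Embedding.map ids G).map_adj_iff.1 (hle (hFH h))
    refine (SimpleGraph.maximal_isAcyclic_iff_reachable_eq hFG (hac.of_comap ids)).2 ?_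
    ext u v
    have h1 := SimpleGraph.reachable_map_iff ids (F.comap ids) u (ids v)
    have h2 := SimpleGraph.reachable_map_iff ids G u (ids v)
    rw [← hmap, hFr, hreach] at h1
    simp only [ids.injective.eq_iff, exists_eq_left] at h1 h2
    rw [← h1, h2]

end Output

/-! ### Sketches and the protocol -/

section Protocol

variable {V : Type*}

/-- An injective ranking of the pairs of identities. -/
noncomputable def edgeRank : Sym2 ℕ → ℕ :=
  Classical.choose (Countable.exists_injective_nat (Sym2 ℕ))

theorem edgeRank_injective : Function.Injective edgeRank :=
  Classical.choose_spec (Countable.exists_injective_nat (Sym2 ℕ))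

/-- The graph on the identities without the edges that have the largest rank in a cycle of length
at most `2 * r`. -/
noncomputable def prunedGraph (r : ℕ) (ids : V ↪ ℕ) (G : SimpleGraph V) : SimpleGraph ℕ :=
  (G.map ids).prune edgeRank (2 * r)

theorem mem_range_of_prunedGraph_adj {r : ℕ} {ids : V ↪ ℕ} {G : SimpleGraph V} {a b : ℕ}
    (h : (prunedGraph r ids G).Adj a b) : a ∈ Set.range ids := by
  obtain ⟨u, v, -, rfl, rfl⟩ := (SimpleGraph.map_adj ids G _ _).1 (SimpleGraph.prune_le _ _ _ h)
  exact ⟨u, rfl⟩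

/-- The identity of a node and the power sums of its neighbourhood in the pruned graph. -/
noncomputable def sketch (r q m : ℕ) (L : LocalView) : ZMod q × (Fin m → ZMod q) :=
  ((L.self : ZMod q), powerSums q m ((L.graph.prune edgeRank (2 * r)).neighborSet L.self))

theorem sketch_localView {r : ℕ} (hr : 1 ≤ r) (q m : ℕ) (ids : V ↪ ℕ) (G : SimpleGraph V) (v : V) :
    sketch r q m (localView ids G r v) =
      ((ids v : ZMod q), powerSums q m ((prunedGraph r ids G).neighborSet (ids v))) := by
  have h : ((localView ids G r v).graph.prune edgeRank (2 * r)).neighborSet (ids v) =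
      (prunedGraph r ids G).neighborSet (ids v) := by
    ext b
    refine SimpleGraph.prune_adj_iff_of_ball (B := ids '' distBall G r v) hr _ ?_ ?_ b
    · intro x y
      simp only [localView, SimpleGraph.map_adj]
      constructor
      · rintro ⟨u, w, h, rfl, rfl⟩
        exact ⟨⟨u, w, h, rfl, rfl⟩, ⟨u, u.2, rfl⟩, ⟨w, w.2, rfl⟩⟩
      · rintro ⟨⟨u, w, h, rfl, rfl⟩, ⟨u', hu', hu⟩, ⟨w', hw', hw⟩⟩
        obtain rfl := ids.injective hu
        obtain rfl := ids.injective hw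
        exact ⟨⟨u', hu'⟩, ⟨w', hw'⟩, h, rfl, rfl⟩
    · intro y w hw
      obtain ⟨u, hu, w', hw'⟩ := SimpleGraph.exists_walk_of_walk_map ids G w rfl
      refine ⟨u, ?_, hu⟩
      exact (SimpleGraph.edist_le w').trans (by exact_mod_cast hw'.trans_le hw)
  rw [sketch, ← h]
  rfl

/-- The sketches of all nodes determine the set of identities and the pruned graph. -/
theorem range_eq_and_prunedGraph_eq_of_sketches_eq [Fintype V] {r q k : ℕ} [Fact q.Prime]
    (hr : 1 ≤ r) (hk : 1 ≤ k) (hcard : Fintype.card V < k ^ r) {ids ids' : V ↪ ℕ}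
    (hids : ∀ v, ids v < q) (hids' : ∀ v, ids' v < q) {G G' : SimpleGraph V}
    (h : (Finset.univ : Finset V).val.map (fun v => sketch r q (2 * k) (localView ids G r v)) =
      (Finset.univ : Finset V).val.map (fun v => sketch r q (2 * k) (localView ids' G' r v))) :
    Set.range ids = Set.range ids' ∧ prunedGraph r ids G = prunedGraph r ids' G' := by
  simp_rw [sketch_localView hr] at h
  have hcast : ∀ {a b : ℕ}, a < q → b < q → (a : ZMod q) = b → a = b := by
    intro a b ha hb hab
    rw [ZMod.natCast_eq_natCast_iff'] at hab
    rwa [Nat.mod_eq_of_lt ha, Nat.mod_eq_of_lt hb] at hab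
  -- The multiset names no senders; the identity inside each sketch, faithful modulo `q`, pairs the
  -- nodes of the two instances.
  have h1 : ∀ v, ∃ v', ids' v' = ids v ∧
      powerSums q (2 * k) ((prunedGraph r ids G).neighborSet (ids v)) =
        powerSums q (2 * k) ((prunedGraph r ids' G').neighborSet (ids v)) := by
    intro v
    have hv := Multiset.mem_map_of_mem (fun v => ((ids v : ZMod q),
      powerSums q (2 * k) ((prunedGraph r ids G).neighborSet (ids v)))) (Finset.mem_univ_val v)
    rw [h] at hv
    obtain ⟨v', -, hv'⟩ := Multiset.mem_map.1 hv
    rw [Prod.mk.injEq] at hv'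
    have he := hcast (hids' v') (hids v) hv'.1
    exact ⟨v', he, by rw [← hv'.2, he]⟩
  have hsub : Set.range ids ⊆ Set.range ids' := by
    rintro _ ⟨v, rfl⟩
    obtain ⟨v', hv', -⟩ := h1 v
    exact ⟨v', hv'⟩
  have hrange : Set.range ids = Set.range ids' := by
    refine Set.eq_of_subset_of_ncard_le hsub ?_ (Set.finite_range ids')
    rw [← Set.image_univ, ← Set.image_univ, Set.ncard_image_of_injective _ ids.injective,
      Set.ncard_image_of_injective _ ids'.injective]
  refine ⟨hrange, ?_⟩
  have hI : ∀ a, a ∈ (Finset.univ : Finset V).map ids ↔ a ∈ Set.range ids := by simp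
  refine SimpleGraph.eq_of_powerSums_neighborSet_eq (q := q) hk (I := (Finset.univ : Finset V).map ids)
    (r := r) ?_ (by simpa using hcard) ?_ ?_ ?_ ?_
  · intro a ha
    obtain ⟨v, rfl⟩ := (hI a).1 ha
    exact hids v
  · exact fun a b hab => (hI a).2 (mem_range_of_prunedGraph_adj hab)
  · exact fun a b hab => (hI a).2 (hrange ▸ mem_range_of_prunedGraph_adj hab)
  · exact fun x c hc => SimpleGraph.lt_length_of_isCycle_prune _ _ c hc
  · intro a ha
    obtain ⟨v, rfl⟩ := (hI a).1 ha
    exact (h1 v).choose_spec.2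

theorem exists_protocol_of_lt_pow {n r q k b N : ℕ} [Fact q.Prime] (hr : 1 ≤ r) (hk : 1 ≤ k)
    (hn : n < k ^ r) (hN : N < q) (hb : q ^ (2 * k + 1) ≤ 2 ^ b) :
    ∃ P : OneRoundProtocol b ConnectivityOutput, ∀ ids : Fin n ↪ ℕ, (∀ v, ids v ≤ N) →
      ∀ G : SimpleGraph (Fin n), ∃ out : ConnectivityOutput,
        out.IsCorrect ids G ∧ ∀ v : Fin n, P.run ids G r v = out := by
  obtain ⟨enc⟩ : Nonempty (ZMod q × (Fin (2 * k) → ZMod q) ↪ (Fin b → Bool)) := by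
    refine Function.Embedding.nonempty_of_card_le ?_
    simpa [ZMod.card, ← pow_succ'] using hb
  let Instance := {p : (Fin n ↪ ℕ) × SimpleGraph (Fin n) // ∀ v, p.1 v ≤ N}
  let msgs : Instance → Multiset (Fin b → Bool) := fun p =>
    (Finset.univ : Finset (Fin n)).val.map
      fun u => enc (sketch r q (2 * k) (localView p.1.1 p.1.2 r u))
  let result : Instance → ConnectivityOutput := fun p =>
    canonicalOutput (Set.range p.1.1) (prunedGraph r p.1.1 p.1.2)
  have hfactor : result.FactorsThrough msgs := by
    intro p p' hpp'
    have h : ((Finset.univ : Finset (Fin n)).val.map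
          fun u => sketch r q (2 * k) (localView p.1.1 p.1.2 r u)) =
        (Finset.univ : Finset (Fin n)).val.map
          fun u => sketch r q (2 * k) (localView p'.1.1 p'.1.2 r u) := by
      refine Multiset.map_injective enc.injective ?_
      rw [Multiset.map_map, Multiset.map_map]
      exact hpp'
    obtain ⟨h1, h2⟩ := range_eq_and_prunedGraph_eq_of_sketches_eq hr hk (by simpa using hn)
      (fun v => (p.2 v).trans_lt hN) (fun v => (p'.2 v).trans_lt hN) h
    simp only [result, h1, h2]
  -- Decoding extends the result from realised message multisets to all; the default value is never
  -- reached on a real run.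
  refine ⟨⟨fun L => enc (sketch r q (2 * k) L), fun _ =>
    Function.extend msgs result fun _ => canonicalOutput ∅ ⊥⟩, fun ids hids G => ?_⟩
  refine ⟨_, canonicalOutput_isCorrect ids (SimpleGraph.prune_le edgeRank (2 * r) _)
    (SimpleGraph.reachable_prune edgeRank_injective (2 * r)), fun v => ?_⟩
  exact hfactor.extend_apply (fun _ => canonicalOutput ∅ ⊥) (⟨(ids, G), hids⟩ : Instance)

/-- Needed separately because `log n = 0` leaves no bits to send. -/
theorem exists_protocol_of_le_one {n : ℕ} (hn : n ≤ 1) (r : ℕ) :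
    ∃ P : OneRoundProtocol 0 ConnectivityOutput, ∀ ids : Fin n ↪ ℕ,
      ∀ G : SimpleGraph (Fin n), ∃ out : ConnectivityOutput,
        out.IsCorrect ids G ∧ ∀ v : Fin n, P.run ids G r v = out := by
  refine ⟨⟨fun _ _ => false, fun L _ => canonicalOutput {L.self} ⊥⟩, fun ids G => ?_⟩
  have : Subsingleton (Fin n) := Fin.subsingleton_iff_le_one.2 hn
  obtain rfl : G = ⊥ := Subsingleton.elim _ _
  refine ⟨canonicalOutput (Set.range ids) ⊥, canonicalOutput_isCorrect ids bot_le ?_, fun v => ?_⟩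
  · rw [show (⊥ : SimpleGraph (Fin n)).map ids = ⊥ by ext a b; simp [SimpleGraph.map_adj]]
  · have : Set.range ids = {ids v} := by
      ext a
      constructor
      · rintro ⟨u, rfl⟩
        rw [Subsingleton.elim u v]
        rfl
      · rintro rfl
        exact ⟨v, rfl⟩
    rw [this]
    rfl

end Protocol

/-! ### Counting bits -/

section Bits

theorem Polynomial.eval_le_eval_one_mul_pow (p : Polynomial ℕ) {n : ℕ} (hn : 1 ≤ n) :
    p.eval n ≤ p.eval 1 * n ^ p.natDegree := by
  rw [Polynomial.eval_eq_sum_range, Polynomial.eval_eq_sum_range, Finset.sum_mul]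
  refine Finset.sum_le_sum fun i hi => ?_
  rw [one_pow, mul_one]
  exact Nat.mul_le_mul_left _ (Nat.pow_le_pow_right hn (Finset.mem_range_succ_iff.1 hi))

/-- A number at most polynomial in `n` has `O(log n)` bits. -/
theorem exists_clog_le_mul_log (p : Polynomial ℕ) :
    ∃ C : ℝ, ∀ n : ℕ, 2 ≤ n → (Nat.clog 2 (2 * (p.eval n + 1)) : ℝ) ≤ C * Real.log n := by
  set A : ℕ := 2 * (p.eval 1 + 1) with hA
  have hlog2 : 0 < Real.log 2 := Real.log_pos one_lt_two
  refine ⟨(Nat.clog 2 A + p.natDegree * 2) / Real.log 2, fun n hn => ?_⟩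
  have h1 : 2 * (p.eval n + 1) ≤ A * n ^ p.natDegree := by
    have h2 := p.eval_le_eval_one_mul_pow (n := n) (by omega)
    have h3 : 1 ≤ n ^ p.natDegree := Nat.one_le_pow _ _ (by omega)
    rw [hA]
    linarith
  have h2 : Nat.clog 2 (2 * (p.eval n + 1)) ≤ Nat.clog 2 A + p.natDegree * Nat.clog 2 n := by
    refine Nat.clog_le_of_le_pow (h1.trans ?_)
    rw [pow_add, mul_comm p.natDegree, pow_mul]
    exact Nat.mul_le_mul (Nat.le_pow_clog one_lt_two _)
      (Nat.pow_le_pow_left (Nat.le_pow_clog one_lt_two _) _)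
  have hratio : 1 ≤ Real.log n / Real.log 2 := by
    rw [one_le_div hlog2]
    exact Real.log_le_log two_pos (by exact_mod_cast hn)
  -- Rounding up costs at most 1, which is at most `log n / log 2` as `n ≥ 2`.
  have h3 : (Nat.clog 2 n : ℝ) ≤ 2 * (Real.log n / Real.log 2) := by
    rw [← Real.natCeil_logb_natCast]
    have h4 := Nat.ceil_lt_add_one (a := Real.logb (2 : ℕ) n)
      (zero_le_one.trans (by simpa [Real.logb] using hratio))
    simp only [Real.logb, Nat.cast_ofNat] at h4 ⊢
    linarith
  calc (Nat.clog 2 (2 * (p.eval n + 1)) : ℝ)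
      ≤ Nat.clog 2 A + p.natDegree * Nat.clog 2 n := by exact_mod_cast h2
    _ ≤ Nat.clog 2 A * (Real.log n / Real.log 2) +
        p.natDegree * (2 * (Real.log n / Real.log 2)) := by
      gcongr
      exact le_mul_of_one_le_right (Nat.cast_nonneg _) hratio
    _ = (Nat.clog 2 A + p.natDegree * 2) / Real.log 2 * Real.log n := by ring

end Bits

theorem mainTheorem4 (idBound : Polynomial ℕ) :
    ∃ C : ℝ, ∀ r : ℕ, 1 ≤ r → ∀ n : ℕ,
      ∃ b : ℕ, (b : ℝ) ≤ C * ((n : ℝ) ^ ((1 : ℝ) / (r : ℝ)) * Real.log (n : ℝ)) ∧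
        ∃ P : OneRoundProtocol b ConnectivityOutput,
          ∀ ids : Fin n ↪ ℕ, (∀ v : Fin n, ids v ≤ idBound.eval n) →
            ∀ G : SimpleGraph (Fin n),
              ∃ out : ConnectivityOutput,
                out.IsCorrect ids G ∧ ∀ v : Fin n, P.run ids G r v = out := by
  obtain ⟨C, hC⟩ := exists_clog_le_mul_log idBound
  refine ⟨5 * C, fun r hr n => ?_⟩
  by_cases hn : n ≤ 1
  · obtain ⟨P, hP⟩ := exists_protocol_of_le_one hn r
    refine ⟨0, ?_, P, fun ids _ G => hP ids G⟩
    have hlog : Real.log n = 0 := by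
      interval_cases n <;> simp
    simp [hlog]
  push Not at hn
  -- Bertrand's postulate keeps `q` polynomial in `n`.
  obtain ⟨q, hq, hNq, hq2⟩ := Nat.exists_prime_lt_and_le_two_mul (idBound.eval n + 1) (by omega)
  have : Fact q.Prime := ⟨hq⟩
  set x : ℝ := (n : ℝ) ^ ((1 : ℝ) / (r : ℝ)) with hx
  have hx1 : 1 ≤ x := Real.one_le_rpow (by exact_mod_cast hn.le) (by positivity)
  have hxr : x ^ r = n := by
    rw [hx, one_div]
    exact Real.rpow_inv_natCast_pow (by positivity) (by omega)
  set k : ℕ := ⌊x⌋₊ + 1 with hk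
  have hnk : n < k ^ r := by
    have h : x ^ r < (k : ℝ) ^ r := by
      refine pow_lt_pow_left₀ ?_ (by positivity) (by omega)
      rw [hk]
      exact_mod_cast Nat.lt_floor_add_one x
    rw [hxr] at h
    exact_mod_cast h
  have hqb : q ^ (2 * k + 1) ≤ 2 ^ ((2 * k + 1) * Nat.clog 2 q) := by
    rw [mul_comm (2 * k + 1), pow_mul]
    exact Nat.pow_le_pow_left (Nat.le_pow_clog one_lt_two q) _
  obtain ⟨P, hP⟩ := exists_protocol_of_lt_pow (b := (2 * k + 1) * Nat.clog 2 q) hr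
    (Nat.le_add_left 1 _) hnk (Nat.lt_of_succ_lt hNq) hqb
  refine ⟨_, ?_, P, hP⟩
  -- Here `2 * k + 1 = 2 * ⌊x⌋₊ + 3`, and `1 ≤ x` absorbs the 3.
  have h1 : ((2 * k + 1 : ℕ) : ℝ) ≤ 5 * x := by
    have := Nat.floor_le (zero_le_one.trans hx1)
    push_cast [hk]
    linarith
  have h2 : (Nat.clog 2 q : ℝ) ≤ C * Real.log n :=
    le_trans (by exact_mod_cast Nat.clog_mono_right 2 hq2) (hC n hn)
  calc (((2 * k + 1) * Nat.clog 2 q : ℕ) : ℝ) =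
      ((2 * k + 1 : ℕ) : ℝ) * Nat.clog 2 q := Nat.cast_mul _ _
    _ ≤ 5 * x * (C * Real.log n) := mul_le_mul h1 h2 (by positivity) (by positivity)
    _ = 5 * C * (x * Real.log n) := by ring
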